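/- Let $a,b,c$ and $\sigma^2>0$ be fixed real numbers, and let $\epsilon=\{\epsilon_{i,j}\}_{i,j\in\mathbb Z}$ be a given collection of pairwise uncorrelated real random variables on a probability space, with zero mean and equal variance $\sigma^2$. Put \[ D=(1-a-b-c)(1-a+b+c)(1+a-b+c)(1+a+b-c). \] A real random field $X=\{X_{i,j}\}_{i,j\in\mathbb Z}$ on that probability space is called wide-sense stationary if all $X_{i,j}$ have finite second moments, $\mathsf E X_{i,j}$ does not depend on $(i,j)$, and $\operatorname{cov}(X_{i,j},X_{i-h_1,j-h_2})$ depends only on $(h_1,h_2)$. Then there is a wide-sense stationary random field $X$ that satisfies \[ X_{i,j}=aX_{i-1,j}+bX_{i,j-1}+cX_{i-1,j-1}+\epsilon_{i,j}\quad\text{almost surely, for all } i,j\in\mathbb Z, \] if and only if $D>0$. Moreover, if $D>0$, then $1-ae^{2\pi\mathrm i\nu_1}-be^{2\pi\mathrm i\nu_2}-ce^{2\pi\mathrm i(\nu_1+\nu_2)}\neq0$ for all real $\nu_1,\nu_2$; the numbers \[ \psi_{k,l}=\int_{-1/2}^{1/2}\int_{-1/2}^{1/2}\frac{\exp(-2\pi\mathrm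 i(k\nu_1+l\nu_2))}{1-ae^{2\pi\mathrm i\nu_1}-be^{2\pi\mathrm i\nu_2}-ce^{2\pi\mathrm i(\nu_1+\nu_2)}}\,d\nu_1\,d\nu_2,\qquad k,l\in\mathbb Z, \] are real and satisfy $\sum_{k,l\in\mathbb Z}|\psi_{k,l}|<\infty$; for all $i,j\in\mathbb Z$ the double series \[ X_{i,j}=\sum_{k=-\infty}^{\infty}\sum_{l=-\infty}^{\infty}\psi_{k,l}\,\epsilon_{i-k,j-l} \] converges absolutely almost surely, and converges unconditionally in mean square to the same limit; and the field $X$ so defined is wide-sense stationary and satisfies the equation above. -/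

import Mathlib

open MeasureTheory ProbabilityTheory Filter Topology

namespace PlanarAR

/-- `ε` is a collection, indexed by `ℤ²`, of square-integrable, pairwise uncorrelated real random
variables with zero mean and equal variance `v`. -/
structure IsWhiteNoise {Ω : Type*} [MeasurableSpace Ω] (μ : Measure Ω) (v : ℝ)
    (ε : ℤ → ℤ → Ω → ℝ) : Prop where
  memLp : ∀ i j, MemLp (ε i j) 2 μ
  mean_zero : ∀ i j, ∫ ω, ε i j ω ∂μ = 0
  variance_eq : ∀ i j, variance (ε i j) μ = v
  uncorrelated : ∀ i j k l, (i, j) ≠ (k, l) → covariance (ε i j) (ε k l) μ = 0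

/-- Wide-sense stationarity of a real random field on `ℤ²`: finite second moments, constant mean,
and `cov (X i j) (X (i - h₁) (j - h₂))` depends on `(h₁, h₂)` only. -/
structure IsWideSenseStationary {Ω : Type*} [MeasurableSpace Ω] (μ : Measure Ω)
    (X : ℤ → ℤ → Ω → ℝ) : Prop where
  memLp : ∀ i j, MemLp (X i j) 2 μ
  mean_const : ∃ m : ℝ, ∀ i j, ∫ ω, X i j ω ∂μ = m
  cov_shift : ∃ γ : ℤ → ℤ → ℝ, ∀ i j h₁ h₂,
    covariance (X i j) (X (i - h₁) (j - h₂)) μ = γ h₁ h₂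

/-- The first-order planar autoregressive equation, as an almost sure equality of random
variables at each lattice point. -/
def SolvesAR {Ω : Type*} [MeasurableSpace Ω] (μ : Measure Ω) (a b c : ℝ)
    (ε X : ℤ → ℤ → Ω → ℝ) : Prop :=
  ∀ i j, ∀ᵐ ω ∂μ,
    X i j ω = a * X (i - 1) j ω + b * X i (j - 1) ω + c * X (i - 1) (j - 1) ω + ε i j ω

/-- The discriminant `D`. -/
def discr (a b c : ℝ) : ℝ :=
  (1 - a - b - c) * (1 - a + b + c) * (1 + a - b + c) * (1 + a + b - c)

/-- The symbol `1 - a e^{2πiν₁} - b e^{2πiν₂} - c e^{2πi(ν₁+ν₂)}`. -/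
noncomputable def symbol (a b c ν₁ ν₂ : ℝ) : ℂ :=
  1 - a * Complex.exp (2 * Real.pi * Complex.I * ν₁)
    - b * Complex.exp (2 * Real.pi * Complex.I * ν₂)
    - c * Complex.exp (2 * Real.pi * Complex.I * (ν₁ + ν₂))

/-- The Fourier coefficients of the reciprocal of the symbol. -/
noncomputable def psi (a b c : ℝ) (k l : ℤ) : ℂ :=
  ∫ ν₂ in (-(1 / 2) : ℝ)..(1 / 2), ∫ ν₁ in (-(1 / 2) : ℝ)..(1 / 2),
    Complex.exp (-(2 * Real.pi * Complex.I * (k * ν₁ + l * ν₂))) / symbol a b c ν₁ ν₂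

/-- The term `ψ_{k,l} ε_{i-k,j-l}`, with `p = (k, l)`. The coefficients `psi` are complex integrals;
their real parts are used here, and the imaginary parts are asserted to vanish in the theorem. -/
noncomputable def maTerm {Ω : Type*} (a b c : ℝ) (ε : ℤ → ℤ → Ω → ℝ) (i j : ℤ) (p : ℤ × ℤ)
    (ω : Ω) : ℝ :=
  (psi a b c p.1 p.2).re * ε (i - p.1) (j - p.2) ω

/-- The two-sided moving average `∑_{k,l} ψ_{k,l} ε_{i-k,j-l}`, summed pointwise. -/
noncomputable def movingAverage {Ω : Type*} (a b c : ℝ) (ε : ℤ → ℤ → Ω → ℝ) (i j : ℤ)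
    (ω : Ω) : ℝ :=
  ∑' p : ℤ × ℤ, maTerm a b c ε i j p ω

end PlanarAR

/-! ### Zeros of the symbol on the torus -/

namespace PlanarAR

/-! With `|z| = |w| = 1`, the symbol vanishes when `1 - az = (b + cz)w`, which forces `|1 - az| = |b
+ cz|`. The difference of the squared moduli is `α - β Re z`, and `D = α² - β²`. It vanishes for
some `Re z` in `[-1, 1]` exactly when `D ≤ 0`, so `D > 0` says that the symbol has no zero on the
torus (`exists_torus_zero`, `symbol_ne_zero`).

Necessity: let `φ(p) = cov(X_p, ε_0)`. Stationarity and Bessel's inequality make `φ`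
square-summable, and the equation makes its image under the autoregressive operator `σ²` times the
unit impulse. If the symbol vanished at `(z, w)`, pairing `φ` with `z^k w^l` times a tent of radius
`R` would leave only increments of the tent, of size `O(1/R)`, on a box of `O(R²)` points. By
Cauchy–Schwarz the pairing tends to `0`, yet it always equals `σ²`
(`eq_zero_of_summable_sq_of_recursion`).

Sufficiency: the reciprocal of a symbol without zeros is smooth and doubly periodic, so its
coefficients `ψ` are absolutely summable (`summable_norm_planarCoeff`), and they invert the operator
(`psi_recursion`). The moving average then converges normally in `L²`, hence absolutely almost
surely, and reindexing it gives the equation. -/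

theorem discr_eq_sq_sub_sq (a b c : ℝ) :
    discr a b c = (1 + a ^ 2 - b ^ 2 - c ^ 2) ^ 2 - (2 * (a + b * c)) ^ 2 := by
  unfold discr; ring

theorem normSq_sub_normSq_of_norm_eq_one (a b c : ℝ) {z : ℂ} (hz : ‖z‖ = 1) :
    ‖1 - a * z‖ ^ 2 - ‖(b : ℂ) + c * z‖ ^ 2
      = (1 + a ^ 2 - b ^ 2 - c ^ 2) - 2 * (a + b * c) * z.re := by
  have h : z.re * z.re + z.im * z.im = 1 := by
    rw [← Complex.normSq_apply, Complex.normSq_eq_norm_sq, hz, one_pow]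
  simp only [← Complex.normSq_eq_norm_sq, Complex.normSq_apply]
  simp
  linear_combination (a ^ 2 - c ^ 2) * h

/-- If the discriminant is nonpositive, then the symbol has a zero on the torus. -/
theorem exists_torus_zero {a b c : ℝ} (h : discr a b c ≤ 0) :
    ∃ z w : ℂ, ‖z‖ = 1 ∧ ‖w‖ = 1 ∧ 1 - a * z - b * w - c * (z * w) = 0 := by
  rw [discr_eq_sq_sub_sq] at h
  set α := 1 + a ^ 2 - b ^ 2 - c ^ 2 with hα
  set β := 2 * (a + b * c) with hβ
  have habs : |α| ≤ |β| := sq_le_sq.1 (by linarith)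
  -- `t` is to be the real part of `z`: it makes the two squared moduli agree.
  obtain ⟨t, ht1, ht⟩ : ∃ t : ℝ, t ^ 2 ≤ 1 ∧ α = β * t := by
    by_cases hb : β = 0
    · refine ⟨0, by norm_num, ?_⟩
      rw [hb, abs_zero] at habs
      simpa using abs_nonpos_iff.1 habs
    · refine ⟨α / β, ?_, by field_simp⟩
      rw [div_pow, div_le_one (by positivity)]
      linarith
  set z : ℂ := ⟨t, Real.sqrt (1 - t ^ 2)⟩ with hzdef
  have hz : ‖z‖ = 1 := by
    rw [← sq_eq_sq₀ (norm_nonneg _) zero_le_one, ← Complex.normSq_eq_norm_sq,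
      Complex.normSq_apply]
    have := Real.mul_self_sqrt (by linarith : 0 ≤ 1 - t ^ 2)
    simp only [hzdef, this]; ring
  have hzn : ‖1 - a * z‖ = ‖(b : ℂ) + c * z‖ := by
    have h1 := normSq_sub_normSq_of_norm_eq_one a b c hz
    have : ‖1 - a * z‖ ^ 2 = ‖(b : ℂ) + c * z‖ ^ 2 := by
      have h2 : z.re = t := rfl
      rw [h2] at h1; linarith
    exact (sq_eq_sq₀ (norm_nonneg _) (norm_nonneg _)).1 this
  -- If both equal moduli are zero, every `w` works; otherwise `w` is the quotient, of modulus one.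
  by_cases h0 : (b : ℂ) + c * z = 0
  · refine ⟨z, 1, hz, norm_one, ?_⟩
    rw [h0, norm_zero, norm_eq_zero] at hzn
    linear_combination hzn - h0
  · refine ⟨z, (1 - a * z) / (b + c * z), hz, ?_, ?_⟩
    · rw [norm_div, hzn, div_self (by simpa using h0)]
    · linear_combination -div_mul_cancel₀ (1 - a * z) h0

theorem symbol_eq (a b c x y : ℝ) :
    symbol a b c x y = 1 - a * Complex.exp (2 * Real.pi * Complex.I * x)
      - b * Complex.exp (2 * Real.pi * Complex.I * y)
      - c * (Complex.exp (2 * Real.pi * Complex.I * x)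
        * Complex.exp (2 * Real.pi * Complex.I * y)) := by
  rw [symbol, ← Complex.exp_add, mul_add]

theorem norm_exp_two_pi_I_mul (x : ℝ) : ‖Complex.exp (2 * Real.pi * Complex.I * x)‖ = 1 := by
  have : (2 * Real.pi * Complex.I * x : ℂ) = ((2 * Real.pi * x : ℝ) : ℂ) * Complex.I := by
    push_cast; ring
  rw [this, Complex.norm_exp_ofReal_mul_I]

/-- If the discriminant is positive, then the symbol has no zero. -/
theorem symbol_ne_zero {a b c : ℝ} (h : 0 < discr a b c) (x y : ℝ) : symbol a b c x y ≠ 0 := by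
  intro h0
  rw [symbol_eq] at h0
  have hz := norm_exp_two_pi_I_mul x
  have hw := norm_exp_two_pi_I_mul y
  generalize Complex.exp (2 * Real.pi * Complex.I * x) = z at *
  generalize Complex.exp (2 * Real.pi * Complex.I * y) = w at *
  have h1 : 1 - a * z = (b + c * z) * w := by linear_combination h0
  have h2 := normSq_sub_normSq_of_norm_eq_one a b c hz
  rw [h1, norm_mul, hw, mul_one, sub_self] at h2
  have h3 : z.re ^ 2 ≤ 1 := by
    rw [← one_pow 2, sq_le_sq, abs_one, ← hz]
    exact Complex.abs_re_le_norm z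
  rw [discr_eq_sq_sub_sq] at h
  -- With `|Re z| ≤ 1` this yields `α² ≤ β²`, contradicting `D > 0`.
  have h4 : 1 + a ^ 2 - b ^ 2 - c ^ 2 = 2 * (a + b * c) * z.re := by linarith
  rw [h4] at h
  nlinarith [sq_nonneg (2 * (a + b * c))]

end PlanarAR

/-! ### Square-summable arrays and a zero of the symbol -/

namespace PlanarAR

/-- The pyramid-shaped cutoff of height one and radius `R` on `ℤ²`. -/
noncomputable def tent (R : ℕ) (p : ℤ × ℤ) : ℝ := max 0 (1 - (|(p.1 : ℝ)| + |(p.2 : ℝ)|) / R)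

theorem tent_zero (R : ℕ) : tent R 0 = 1 := by simp [tent]

theorem tent_eq_zero {R : ℕ} (hR : 0 < R) {p : ℤ × ℤ}
    (hp : (R : ℝ) ≤ |(p.1 : ℝ)| + |(p.2 : ℝ)|) : tent R p = 0 := by
  have hR' : (0 : ℝ) < R := by exact_mod_cast hR
  rw [tent, max_eq_left]
  rw [sub_nonpos, le_div_iff₀ hR']
  linarith

/-- Truncation at zero and absolute values are 1-Lipschitz, so only the slope `1/R` remains. -/
theorem abs_tent_add_sub_le (R : ℕ) (p q : ℤ × ℤ) :
    |tent R (p + q) - tent R p| ≤ (|(q.1 : ℝ)| + |(q.2 : ℝ)|) / R := by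
  refine (abs_max_sub_max_le_max _ _ _ _).trans ?_
  have h1 := abs_abs_sub_abs_le ((p.1 : ℝ) + q.1) p.1
  have h2 := abs_abs_sub_abs_le ((p.2 : ℝ) + q.2) p.2
  rw [add_sub_cancel_left] at h1 h2
  rw [sub_self, abs_zero, max_eq_right (abs_nonneg _), sub_sub_sub_cancel_left, ← sub_div, abs_div,
    Nat.abs_cast]
  gcongr
  simp only [Prod.fst_add, Prod.snd_add, Int.cast_add]
  rw [abs_sub_comm, add_sub_add_comm]
  exact (abs_add_le _ _).trans (add_le_add h1 h2)

/-- Sums of the absolute values of a square-summable family over sets of at most `r ^ 2` elements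
are `o(r)`. -/
theorem sum_abs_le_of_summable_sq {ι : Type*} [DecidableEq ι] {f : ι → ℝ}
    (hf : Summable fun i => f i ^ 2) {η : ℝ} (hη : 0 < η) :
    ∃ S : ℝ, ∀ (B : Finset ι) (r : ℝ), 0 ≤ r → (B.card : ℝ) ≤ r ^ 2 →
      ∑ i ∈ B, |f i| ≤ S + r * η := by
  obtain ⟨F, hF⟩ := summable_iff_vanishing_norm.1 hf (η ^ 2) (by positivity)
  refine ⟨∑ i ∈ F, |f i|, fun B r hr hB => ?_⟩
  have h1 : ∑ i ∈ B, |f i| ≤ ∑ i ∈ F, |f i| + ∑ i ∈ B \ F, |f i| := by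
    rw [← Finset.sum_union Finset.disjoint_sdiff, Finset.union_sdiff_self_eq_union]
    exact Finset.sum_le_sum_of_subset_of_nonneg Finset.subset_union_right
      fun _ _ _ => abs_nonneg _
  refine h1.trans (add_le_add le_rfl ?_)
  have h2 := hF (B \ F) Finset.sdiff_disjoint
  -- Cauchy–Schwarz off `F`: at most `r²` terms, whose squares sum to less than `η²`.
  have h3 := sq_sum_le_card_mul_sum_sq (s := B \ F) (f := fun i => |f i|)
  simp only [sq_abs] at h3
  refine (sq_le_sq₀ (Finset.sum_nonneg fun _ _ => abs_nonneg _) (by positivity)).1 ?_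
  rw [mul_pow]
  refine h3.trans (mul_le_mul ?_ ((le_abs_self _).trans h2.le) ?_ (by positivity))
  · exact le_trans (by exact_mod_cast Finset.card_le_card Finset.sdiff_subset) hB
  · exact Finset.sum_nonneg fun _ _ => sq_nonneg _

/-- Summation by parts against a finitely supported weight. -/
theorem mul_eq_tsum_of_recursion {a b c v : ℝ} {φ : ℤ × ℤ → ℝ}
    (hrec : ∀ p, φ p = a * φ (p - (1, 0)) + b * φ (p - (0, 1)) + c * φ (p - (1, 1))
      + if p = 0 then v else 0) {G : ℤ × ℤ → ℂ} (hG : G.support.Finite) :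
    v * G 0 = ∑' p, φ p * (G p - a * G (p + (1, 0)) - b * G (p + (0, 1)) - c * G (p + (1, 1))) := by
  have hs : ∀ ψ : ℤ × ℤ → ℂ, Summable fun p => ψ p * G p := fun ψ =>
    summable_of_hasFiniteSupport (hG.subset (Function.support_mul_subset_right _ _))
  have hshift : ∀ e, HasSum (fun p => (φ p : ℂ) * G (p + e)) (∑' p, (φ (p - e) : ℂ) * G p) := by
    intro e
    have h := (Equiv.addRight e).hasSum_iff.2 (hs fun p => (φ (p - e) : ℂ)).hasSum
    convert h using 2 with p
    simp
  have h0 : HasSum (fun p => (if p = 0 then (v : ℂ) else 0) * G p) (v * G 0) := by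
    convert hasSum_ite_eq (0 : ℤ × ℤ) ((v : ℂ) * G 0) using 2 with p
    split_ifs with h
    · rw [h]
    · rw [zero_mul]
  -- `h1` carries the shifts on `φ`, where the recursion collapses them to the impulse; `h2` is the
  -- same sum with the shifts moved onto `G`.
  have h1 := (((hs fun p => (φ p : ℂ)).hasSum.sub
    ((hs fun p => (φ (p - (1, 0)) : ℂ)).hasSum.mul_left (a : ℂ))).sub
    ((hs fun p => (φ (p - (0, 1)) : ℂ)).hasSum.mul_left (b : ℂ))).sub
    ((hs fun p => (φ (p - (1, 1)) : ℂ)).hasSum.mul_left (c : ℂ))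
  have h2 := ((((hs fun p => (φ p : ℂ)).hasSum.sub
    ((hshift (1, 0)).mul_left (a : ℂ))).sub
    ((hshift (0, 1)).mul_left (b : ℂ))).sub
    ((hshift (1, 1)).mul_left (c : ℂ))).tsum_eq
  have h3 := h1.unique (h0.congr_fun fun p => ?_)
  · rw [← h3, ← h2]
    exact tsum_congr fun p => by ring
  · have := congrArg (fun x : ℝ => (x : ℂ)) (hrec p)
    simp only [Complex.ofReal_add, Complex.ofReal_mul] at this
    rw [apply_ite Complex.ofReal, Complex.ofReal_zero] at this
    linear_combination G p * this

/-- If the symbol has a zero on the torus, then a multiple of the unit impulse that is the image of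
a square-summable array under the autoregressive operator vanishes. -/
theorem eq_zero_of_summable_sq_of_recursion {a b c v : ℝ} {φ : ℤ × ℤ → ℝ}
    (hφ : Summable fun p => φ p ^ 2)
    (hrec : ∀ p, φ p = a * φ (p - (1, 0)) + b * φ (p - (0, 1)) + c * φ (p - (1, 1))
      + if p = 0 then v else 0) {z w : ℂ} (hz : ‖z‖ = 1) (hw : ‖w‖ = 1)
    (h0 : 1 - a * z - b * w - c * (z * w) = 0) : v = 0 := by
  classical
  have hz0 : z ≠ 0 := norm_ne_zero_iff.1 (by simp [hz])
  have hw0 : w ≠ 0 := norm_ne_zero_iff.1 (by simp [hw])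
  -- The tent changes by at most `1/R` along a unit step and `2/R` along the diagonal one.
  set C : ℝ := |a| + |b| + 2 * |c| with hC
  have hC0 : 0 ≤ C := by positivity
  -- The margin beyond `R` ensures that outside the box the shifted points also miss the tent.
  set B : ℕ → Finset (ℤ × ℤ) := fun R =>
    Finset.Icc (-(R + 1 : ℤ)) (R + 1) ×ˢ Finset.Icc (-(R + 1 : ℤ)) (R + 1) with hB
  have hcard : ∀ R : ℕ, 0 < R → ((B R).card : ℝ) ≤ (5 * R : ℝ) ^ 2 := by
    intro R hR
    rw [hB, Finset.card_product, Int.card_Icc]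
    have : ((R + 1 : ℤ) + 1 - -(R + 1 : ℤ)).toNat ≤ 5 * R := by omega
    rw [← pow_two]
    exact_mod_cast Nat.pow_le_pow_left this 2
  have key : ∀ R : ℕ, 0 < R → |v| ≤ C / R * ∑ p ∈ B R, |φ p| := by
    intro R hR
    have hR' : (0 : ℝ) < R := by exact_mod_cast hR
    set G : ℤ × ℤ → ℂ := fun p => z ^ p.1 * w ^ p.2 * tent R p with hGdef
    have hGB : ∀ p e : ℤ × ℤ, |e.1| ≤ 1 → |e.2| ≤ 1 → p ∉ B R → G (p + e) = 0 := by
      intro p e h1 h2 hp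
      have : (R : ℤ) ≤ |p.1 + e.1| + |p.2 + e.2| := by
        simp only [hB, Finset.mem_product, Finset.mem_Icc] at hp
        rw [abs_le] at h1 h2
        have a1 := le_abs_self (p.1 + e.1)
        have a2 := neg_abs_le (p.1 + e.1)
        have a3 := le_abs_self (p.2 + e.2)
        have a4 := neg_abs_le (p.2 + e.2)
        omega
      have h3 : tent R (p + e) = 0 := tent_eq_zero hR (by exact_mod_cast this)
      simp [hGdef, h3]
    have hGf : G.support.Finite := (B R).finite_toSet.subset fun p hp => by
      by_contra h
      exact hp (by simpa using hGB p 0 (by simp) (by simp) h)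
    have h1 := mul_eq_tsum_of_recursion hrec hGf
    have hG0 : G 0 = 1 := by simp [hGdef, tent_zero]
    rw [hG0, mul_one, tsum_eq_sum (s := B R)] at h1
    · have h2 : |v| = ‖(v : ℂ)‖ := by simp
      rw [h2, h1, Finset.mul_sum]
      refine (norm_sum_le _ _).trans (Finset.sum_le_sum fun p _ => ?_)
      rw [norm_mul, Complex.norm_real, Real.norm_eq_abs, mul_comm]
      refine mul_le_mul_of_nonneg_right ?_ (abs_nonneg _)
      -- The pure exponential is annihilated because the symbol vanishes at `(z, w)`.
      have h3 : G p - a * G (p + (1, 0)) - b * G (p + (0, 1)) - c * G (p + (1, 1))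
          = -(z ^ p.1 * w ^ p.2 * (a * z * (tent R (p + (1, 0)) - tent R p : ℝ)
            + b * w * (tent R (p + (0, 1)) - tent R p : ℝ)
            + c * (z * w) * (tent R (p + (1, 1)) - tent R p : ℝ))) := by
        simp only [hGdef, Prod.fst_add, Prod.snd_add, zpow_add₀ hz0, zpow_add₀ hw0, zpow_one,
          add_zero, Complex.ofReal_sub]
        linear_combination (z ^ p.1 * w ^ p.2 * tent R p) * h0
      rw [h3, norm_neg, norm_mul, norm_mul, norm_zpow, norm_zpow, hz, hw, one_zpow, one_zpow,
        one_mul, one_mul]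
      refine (norm_add₃_le).trans ?_
      simp only [norm_mul, Complex.norm_real, hz, hw, mul_one, Real.norm_eq_abs]
      have t1 := abs_tent_add_sub_le R p (1, 0)
      have t2 := abs_tent_add_sub_le R p (0, 1)
      have t3 := abs_tent_add_sub_le R p (1, 1)
      norm_num at t1 t2 t3
      calc _ ≤ |a| * (R : ℝ)⁻¹ + |b| * (R : ℝ)⁻¹ + |c| * (2 / R) := by gcongr
        _ = C / R := by rw [hC]; ring
    · intro p hp
      have g0 := hGB p 0 (by simp) (by simp) hp
      rw [add_zero] at g0
      rw [g0, hGB p _ (by simp) (by simp) hp, hGB p _ (by simp) (by simp) hp,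
        hGB p _ (by simp) (by simp) hp]
      simp
  -- The box has at most `(5R)²` points; `R → ∞` removes the constant `S`, and then `η → 0`.
  have hlim : ∀ η : ℝ, 0 < η → |v| ≤ C * (5 * η) := by
    intro η hη
    obtain ⟨S, hS⟩ := sum_abs_le_of_summable_sq hφ hη
    have hT : Tendsto (fun R : ℕ => C * (S / R + 5 * η)) atTop (𝓝 (C * (0 + 5 * η))) :=
      ((tendsto_const_div_atTop_nhds_zero_nat S).add_const _).const_mul _
    rw [zero_add] at hT
    refine ge_of_tendsto hT ((eventually_gt_atTop 0).mono fun R hR => (key R hR).trans ?_)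
    have hR' : (0 : ℝ) < R := by exact_mod_cast hR
    have := hS (B R) (5 * R) (by positivity) (hcard R hR)
    calc C / R * ∑ p ∈ B R, |φ p| ≤ C / R * (S + 5 * R * η) := by gcongr
      _ = C * (S / R + 5 * η) := by field_simp
  have hT : Tendsto (fun η : ℝ => C * (5 * η)) (𝓝[>] 0) (𝓝 (C * (5 * 0))) :=
    ((tendsto_id.const_mul 5).const_mul C).mono_left nhdsWithin_le_nhds
  have := ge_of_tendsto hT (eventually_mem_nhdsWithin.mono fun η hη => hlim η hη)
  simpa using this

end PlanarAR

/-! ### Necessity of a positive discriminant -/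

namespace PlanarAR

variable {Ω : Type*} [MeasurableSpace Ω] {μ : Measure Ω}

theorem covariance_congr_ae {X X' Y Y' : Ω → ℝ} (hX : X =ᵐ[μ] X') (hY : Y =ᵐ[μ] Y') :
    covariance X Y μ = covariance X' Y' μ := by
  unfold covariance
  rw [integral_congr_ae hX, integral_congr_ae hY]
  refine integral_congr_ae ?_
  filter_upwards [hX, hY] with ω h1 h2
  rw [h1, h2]

/-- Bessel's inequality for uncorrelated random variables of equal variance. -/
theorem summable_sq_covariance [IsProbabilityMeasure μ] {ι : Type*} {v : ℝ} (hv : 0 < v)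
    {X : Ω → ℝ} {e : ι → Ω → ℝ} (hX : MemLp X 2 μ) (he : ∀ i, MemLp (e i) 2 μ)
    (hvar : ∀ i, variance (e i) μ = v)
    (hcov : ∀ i j, i ≠ j → covariance (e i) (e j) μ = 0) :
    Summable fun i => covariance X (e i) μ ^ 2 := by
  classical
  refine summable_of_sum_le (c := v * variance X μ) (fun _ => sq_nonneg _) fun s => ?_
  set S := ∑ i ∈ s, covariance X (e i) μ ^ 2 with hS
  set Y : Ω → ℝ := ∑ i ∈ s, covariance X (e i) μ • e i with hY
  have hmem : ∀ i ∈ s, MemLp (covariance X (e i) μ • e i) 2 μ := fun i _ => (he i).const_smul _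
  have hYL : MemLp Y 2 μ := memLp_finsetSum' s hmem
  have hXY : covariance X Y μ = S := by
    rw [hY, covariance_sum_right' hmem hX]
    exact Finset.sum_congr rfl fun i _ => by rw [covariance_smul_right, pow_two]
  have hYY : covariance Y Y μ = v * S := by
    nth_rw 1 [hY]
    rw [covariance_sum_left' hmem hYL, hS, Finset.mul_sum]
    refine Finset.sum_congr rfl fun i hi => ?_
    rw [covariance_smul_left, hY, covariance_sum_right' hmem (he i), Finset.sum_eq_single i]
    · rw [covariance_smul_right, covariance_self (he i).aemeasurable, hvar]; ring
    · intro j _ hj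
      rw [covariance_smul_right, hcov i j hj.symm, mul_zero]
    · exact fun h => absurd hi h
  -- This variance equals `v (v Var X - S)`.
  have h0 := variance_nonneg (v • X - Y) μ
  have hvX : MemLp (v • X) 2 μ := hX.const_smul v
  rw [← covariance_self (hvX.sub hYL).aemeasurable,
    covariance_sub_sub hvX hYL hvX hYL, covariance_smul_left, covariance_smul_right,
    covariance_smul_left, covariance_smul_right, hYY, covariance_comm Y X, hXY,
    covariance_self hX.aemeasurable] at h0
  have : 0 ≤ v * (v * variance X μ - S) := by linarith
  have := nonneg_of_mul_nonneg_right this hv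
  linarith

/-- A stationary solution forces the discriminant to be positive. -/
theorem discr_pos_of_exists [IsProbabilityMeasure μ] {a b c v : ℝ} (hv : 0 < v)
    {ε X : ℤ → ℤ → Ω → ℝ} (hε : IsWhiteNoise μ v ε) (hX : IsWideSenseStationary μ X)
    (hAR : SolvesAR μ a b c ε X) : 0 < discr a b c := by
  by_contra hD
  obtain ⟨z, w, hz, hw, h0⟩ := exists_torus_zero (not_lt.1 hD)
  obtain ⟨γ, hγ⟩ := hX.cov_shift
  have hXL := hX.memLp
  set φ : ℤ × ℤ → ℝ := fun p => covariance (X p.1 p.2) (ε 0 0) μ with hφ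
  have hεeq : ∀ i j, ε i j =ᵐ[μ]
      X i j - a • X (i - 1) j - b • X i (j - 1) - c • X (i - 1) (j - 1) := by
    intro i j
    filter_upwards [hAR i j] with ω h
    simp only [Pi.sub_apply, Pi.smul_apply, smul_eq_mul]
    linarith
  -- Noise is a fixed combination of shifts of `X`, so its covariance with `X` depends only on the
  -- lag.
  have hcovε : ∀ i j k l, covariance (X i j) (ε k l) μ = γ (i - k) (j - l)
      - a * γ (i - k + 1) (j - l) - b * γ (i - k) (j - l + 1)
      - c * γ (i - k + 1) (j - l + 1) := by
    intro i j k l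
    have hg : ∀ k' l', covariance (X i j) (X k' l') μ = γ (i - k') (j - l') := by
      intro k' l'
      rw [← hγ i j, sub_sub_cancel, sub_sub_cancel]
    have m1 : ∀ (r : ℝ) (k l : ℤ), MemLp (r • X k l) 2 μ := fun r k l => (hXL k l).const_smul r
    rw [covariance_congr_ae (ae_eq_refl _) (hεeq k l),
      covariance_sub_right (hXL i j)
        (((hXL k l).sub (m1 a (k - 1) l)).sub (m1 b k (l - 1))) (m1 c (k - 1) (l - 1)),
      covariance_sub_right (hXL i j) ((hXL k l).sub (m1 a (k - 1) l)) (m1 b k (l - 1)),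
      covariance_sub_right (hXL i j) (hXL k l) (m1 a (k - 1) l),
      covariance_smul_right, covariance_smul_right, covariance_smul_right, hg, hg, hg, hg]
    simp only [sub_sub_eq_add_sub, sub_add_eq_add_sub]
  -- By lag invariance `φ p = cov(X_0, ε_{-p})`, so Bessel applies to the single variable `X 0 0`.
  have hsum : Summable fun p : ℤ × ℤ => φ p ^ 2 := by
    have h1 := summable_sq_covariance hv (hXL 0 0) (e := fun p : ℤ × ℤ => ε (-p.1) (-p.2))
      (fun p => hε.memLp _ _) (fun p => hε.variance_eq _ _) (fun p q hpq => by
        refine hε.uncorrelated _ _ _ _ fun h => hpq ?_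
        simpa [Prod.ext_iff] using h)
    refine h1.congr fun p => ?_
    simp only [hφ, hcovε, zero_sub, neg_neg, sub_zero]
  have hrec : ∀ p, φ p = a * φ (p - (1, 0)) + b * φ (p - (0, 1)) + c * φ (p - (1, 1))
      + if p = 0 then v else 0 := by
    rintro ⟨i, j⟩
    have m1 : ∀ (r : ℝ) (k l : ℤ), MemLp (r • X k l) 2 μ := fun r k l => (hXL k l).const_smul r
    have h1 : covariance (ε i j) (ε 0 0) μ = if (i, j) = (0 : ℤ × ℤ) then v else 0 := by
      split_ifs with h
      · obtain ⟨rfl, rfl⟩ := Prod.mk.inj h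
        rw [covariance_self (hε.memLp _ _).aemeasurable, hε.variance_eq]
      · exact hε.uncorrelated _ _ _ _ h
    rw [← h1, covariance_congr_ae (hεeq i j) (ae_eq_refl _),
      covariance_sub_left
        (((hXL i j).sub (m1 a (i - 1) j)).sub (m1 b i (j - 1))) (m1 c (i - 1) (j - 1))
        (hε.memLp 0 0),
      covariance_sub_left ((hXL i j).sub (m1 a (i - 1) j)) (m1 b i (j - 1)) (hε.memLp 0 0),
      covariance_sub_left (hXL i j) (m1 a (i - 1) j) (hε.memLp 0 0),
      covariance_smul_left, covariance_smul_left, covariance_smul_left]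
    simp only [hφ, Prod.fst_sub, Prod.snd_sub, sub_zero]
    ring
  exact hv.ne' (eq_zero_of_summable_sq_of_recursion hsum hrec hz hw h0)

end PlanarAR

/-! ### Fourier coefficients of smooth doubly periodic functions -/

namespace PlanarAR

/-- The exponential `e^{-2πi(kx+ly)}`. -/
noncomputable def character (k l : ℤ) (p : ℝ × ℝ) : ℂ :=
  Complex.exp (-(2 * Real.pi * Complex.I * (k * p.1 + l * p.2)))

/-- The Fourier coefficients of a function on the plane over the unit square about the origin. -/
noncomputable def planarCoeff (f : ℝ × ℝ → ℂ) (k l : ℤ) : ℂ :=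
  ∫ y in (-(1 / 2) : ℝ)..(1 / 2), ∫ x in (-(1 / 2) : ℝ)..(1 / 2), character k l (x, y) * f (x, y)

theorem continuous_character (k l : ℤ) : Continuous (character k l) := by
  unfold character; fun_prop

theorem norm_character (k l : ℤ) (p : ℝ × ℝ) : ‖character k l p‖ = 1 := by
  have : (-(2 * Real.pi * Complex.I * (k * p.1 + l * p.2)) : ℂ)
      = ((-(2 * Real.pi * (k * p.1 + l * p.2)) : ℝ) : ℂ) * Complex.I := by
    push_cast; ring
  rw [character, this, Complex.norm_exp_ofReal_mul_I]

theorem character_add_fst (k l : ℤ) (x y : ℝ) :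
    character k l (x + 1, y) = character k l (x, y) := by
  have : (-(2 * Real.pi * Complex.I * (k * ((x + 1 : ℝ) : ℂ) + l * y)) : ℂ)
      = -(2 * Real.pi * Complex.I * (k * x + l * y)) + ((-k : ℤ) : ℂ) * (2 * Real.pi * Complex.I) := by
    push_cast; ring
  simp only [character]
  rw [this, Complex.exp_add, Complex.exp_int_mul_two_pi_mul_I, mul_one]

/-- Fubini; it transfers results on the first variable to the second. -/
theorem planarCoeff_swap {f : ℝ × ℝ → ℂ} (hf : Continuous f) (k l : ℤ) :
    planarCoeff (fun p => f p.swap) l k = planarCoeff f k l := by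
  unfold planarCoeff
  rw [intervalIntegral_intervalIntegral_swap]
  · simp only [character, Prod.swap_prod_mk]
    simp only [add_comm]
  · have : Continuous (Function.uncurry fun y x => character l k (x, y) * f (x, y).swap) := by
      have := continuous_character l k
      simp only [Function.uncurry_def, Prod.swap_prod_mk]
      fun_prop
    exact (this.continuousOn.integrableOn_compact
      (isCompact_uIcc.prod isCompact_uIcc)).mono_set
        (Set.prod_mono Set.uIoc_subset_uIcc Set.uIoc_subset_uIcc)

theorem planarCoeff_sub {f g : ℝ × ℝ → ℂ} (hf : Continuous f) (hg : Continuous g) (k l : ℤ) :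
    planarCoeff (fun p => f p - g p) k l = planarCoeff f k l - planarCoeff g k l := by
  have hc := continuous_character k l
  have hi : ∀ {h : ℝ × ℝ → ℂ}, Continuous h → ∀ y, IntervalIntegrable
      (fun x => character k l (x, y) * h (x, y)) volume (-(1 / 2)) (1 / 2) := fun hh y =>
    Continuous.intervalIntegrable (by fun_prop) _ _
  have ho : ∀ {h : ℝ × ℝ → ℂ}, Continuous h → IntervalIntegrable
      (fun y => ∫ x in (-(1 / 2) : ℝ)..(1 / 2), character k l (x, y) * h (x, y))
      volume (-(1 / 2)) (1 / 2) := fun hh =>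
    Continuous.intervalIntegrable
      (intervalIntegral.continuous_parametric_intervalIntegral_of_continuous'
        (by simp only [Function.uncurry_def]; fun_prop) _ _) _ _
  unfold planarCoeff
  rw [← intervalIntegral.integral_sub (ho hf) (ho hg)]
  congr 1 with y
  rw [← intervalIntegral.integral_sub (hi hf y) (hi hg y)]
  congr 1 with x
  ring

theorem planarCoeff_const_mul (r : ℂ) (f : ℝ × ℝ → ℂ) (k l : ℤ) :
    planarCoeff (fun p => r * f p) k l = r * planarCoeff f k l := by
  simp only [planarCoeff, mul_left_comm _ r, intervalIntegral.integral_const_mul]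

theorem planarCoeff_character_mul (m n : ℤ) (f : ℝ × ℝ → ℂ) (k l : ℤ) :
    planarCoeff (fun p => character m n p * f p) k l = planarCoeff f (k + m) (l + n) := by
  simp only [planarCoeff, ← mul_assoc]
  congr! with y x
  simp only [character]
  rw [← Complex.exp_add]
  congr 1
  push_cast
  ring

theorem exists_norm_planarCoeff_le {f : ℝ × ℝ → ℂ} (hf : Continuous f) :
    ∃ M, ∀ k l, ‖planarCoeff f k l‖ ≤ M := by
  obtain ⟨M, hM⟩ := ((isCompact_uIcc (a := (-(1 / 2) : ℝ)) (b := 1 / 2)).prod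
    (isCompact_uIcc (a := (-(1 / 2) : ℝ)) (b := 1 / 2))).exists_bound_of_continuousOn
      hf.continuousOn
  refine ⟨M, fun k l => ?_⟩
  have h1 : ∀ y ∈ Set.uIoc (-(1 / 2) : ℝ) (1 / 2),
      ‖∫ x in (-(1 / 2) : ℝ)..(1 / 2), character k l (x, y) * f (x, y)‖ ≤ M := by
    intro y hy
    refine (intervalIntegral.norm_integral_le_of_norm_le_const (C := M) fun x hx => ?_).trans ?_
    · rw [norm_mul, norm_character, one_mul]
      exact hM _ ⟨Set.uIoc_subset_uIcc hx, Set.uIoc_subset_uIcc hy⟩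
    · norm_num
  refine (intervalIntegral.norm_integral_le_of_norm_le_const h1).trans ?_
  norm_num

/-- Integration by parts in the first variable. -/
theorem planarCoeff_fderiv_fst {f : ℝ × ℝ → ℂ} (hf : ContDiff ℝ 1 f)
    (hper : ∀ p, f (p + (1, 0)) = f p) (k l : ℤ) :
    planarCoeff (fun p => fderiv ℝ f p (1, 0)) k l
      = 2 * Real.pi * Complex.I * k * planarCoeff f k l := by
  unfold planarCoeff
  rw [← intervalIntegral.integral_const_mul]
  congr 1 with y
  have hc := continuous_character k l
  have hf' : Continuous fun p => fderiv ℝ f p (1, 0) :=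
    (hf.continuous_fderiv one_ne_zero).clm_apply continuous_const
  have hu : ∀ x : ℝ, HasDerivAt (fun x : ℝ => character k l (x, y))
      (-(2 * Real.pi * Complex.I * k) * character k l (x, y)) x := by
    intro x
    have h1 : HasDerivAt (fun x : ℂ => Complex.exp (-(2 * Real.pi * Complex.I * (k * x + l * y))))
        (Complex.exp (-(2 * Real.pi * Complex.I * (k * x + l * y)))
          * -(2 * Real.pi * Complex.I * (k * 1))) x :=
      ((((hasDerivAt_id (x : ℂ)).const_mul (k : ℂ)).add_const _).const_mul _).neg.cexp
    refine h1.comp_ofReal.congr_deriv ?_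
    simp only [character]; ring
  have hv : ∀ x : ℝ, HasDerivAt (fun x : ℝ => f (x, y)) (fderiv ℝ f (x, y) (1, 0)) x := by
    intro x
    exact ((hf.differentiable one_ne_zero (x, y)).hasFDerivAt).comp_hasDerivAt x
      ((hasDerivAt_id x).prodMk (hasDerivAt_const x y))
  rw [intervalIntegral.integral_mul_deriv_eq_deriv_mul (fun x _ => hu x) (fun x _ => hv x)
    (Continuous.intervalIntegrable (by fun_prop) _ _)
    (Continuous.intervalIntegrable (by fun_prop) _ _)]
  -- The endpoints differ by one period, so the boundary terms cancel.
  have e1 : character k l (1 / 2, y) = character k l (-(1 / 2), y) := by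
    rw [← character_add_fst k l (-(1 / 2)) y]; norm_num
  have e2 : f (1 / 2, y) = f (-(1 / 2), y) := by
    rw [← hper (-(1 / 2), y)]; norm_num
  simp only [e1, e2, sub_self, zero_sub, mul_assoc, neg_mul, intervalIntegral.integral_neg, neg_neg,
    intervalIntegral.integral_const_mul]

/-- Integration by parts in the second variable. -/
theorem planarCoeff_fderiv_snd {f : ℝ × ℝ → ℂ} (hf : ContDiff ℝ 1 f)
    (hper : ∀ p, f (p + (0, 1)) = f p) (k l : ℤ) :
    planarCoeff (fun p => fderiv ℝ f p (0, 1)) k l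
      = 2 * Real.pi * Complex.I * l * planarCoeff f k l := by
  have hf' : Continuous fun p => fderiv ℝ f p (0, 1) :=
    (hf.continuous_fderiv one_ne_zero).clm_apply continuous_const
  have h0 := planarCoeff_fderiv_fst (f := fun p => f p.swap)
    (hf.comp (contDiff_snd.prodMk contDiff_fst)) (fun p => by simpa using hper p.swap) l k
  rw [← planarCoeff_swap hf', ← planarCoeff_swap hf.continuous, ← h0]
  congr 1 with p
  have h1 := (hf.differentiable one_ne_zero p.swap).hasFDerivAt.comp p
    (ContinuousLinearEquiv.prodComm ℝ ℝ ℝ).hasFDerivAt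
  change _ = fderiv ℝ (f ∘ Prod.swap) p (1, 0)
  rw [h1.fderiv]
  simp

/-- Directional derivatives of smooth doubly periodic functions are smooth and doubly periodic. -/
theorem smooth_periodic_fderiv {f : ℝ × ℝ → ℂ} (hf : ContDiff ℝ (⊤ : ℕ∞) f)
    (h1 : ∀ p, f (p + (1, 0)) = f p) (h2 : ∀ p, f (p + (0, 1)) = f p) (e : ℝ × ℝ) :
    ContDiff ℝ (⊤ : ℕ∞) (fun p => fderiv ℝ f p e) ∧
      (∀ p, fderiv ℝ f (p + (1, 0)) e = fderiv ℝ f p e) ∧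
      ∀ p, fderiv ℝ f (p + (0, 1)) e = fderiv ℝ f p e := by
  refine ⟨(hf.fderiv_right (m := (⊤ : ℕ∞)) (by simp)).clm_apply contDiff_const,
    fun p => ?_, fun p => ?_⟩
  · rw [← fderiv_comp_add_right, funext h1]
  · rw [← fderiv_comp_add_right, funext h2]

theorem summable_inv_one_add_sq : Summable fun k : ℤ => (1 + (k : ℝ) ^ 2)⁻¹ := by
  refine Summable.of_norm_bounded_eventually (g := fun k : ℤ => 1 / (k : ℝ) ^ 2)
    (Real.summable_one_div_int_pow.2 one_lt_two) ?_
  filter_upwards [(Set.finite_singleton (0 : ℤ)).compl_mem_cofinite] with k hk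
  have hk' : (k : ℝ) ≠ 0 := by exact_mod_cast hk
  rw [Real.norm_of_nonneg (by positivity), one_div]
  gcongr
  linarith

/-- The Fourier coefficients of a smooth doubly periodic function are absolutely summable. -/
theorem summable_norm_planarCoeff {f : ℝ × ℝ → ℂ} (hf : ContDiff ℝ (⊤ : ℕ∞) f)
    (h1 : ∀ p, f (p + (1, 0)) = f p) (h2 : ∀ p, f (p + (0, 1)) = f p) :
    Summable fun p : ℤ × ℤ => ‖planarCoeff f p.1 p.2‖ := by
  have hle : ((1 : ℕ) : WithTop ℕ∞) ≤ ((⊤ : ℕ∞) : WithTop ℕ∞) := by exact_mod_cast le_top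
  have one : ∀ {g : ℝ × ℝ → ℂ}, ContDiff ℝ (⊤ : ℕ∞) g → (∀ p, g (p + (1, 0)) = g p) →
      (∀ p, g (p + (0, 1)) = g p) → ∃ g', ContDiff ℝ (⊤ : ℕ∞) g' ∧ (∀ p, g' (p + (1, 0)) = g' p) ∧
      (∀ p, g' (p + (0, 1)) = g' p) ∧
      ∀ k l : ℤ, (k : ℝ) ^ 2 * ‖planarCoeff g k l‖ ≤ ‖planarCoeff g' k l‖ := by
    intro g hg g1 g2
    obtain ⟨a0, a1, a2⟩ := smooth_periodic_fderiv hg g1 g2 (1, 0)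
    obtain ⟨b0, b1, b2⟩ := smooth_periodic_fderiv a0 a1 a2 (1, 0)
    refine ⟨_, b0, b1, b2, fun k l => ?_⟩
    rw [planarCoeff_fderiv_fst (a0.of_le hle) a1, planarCoeff_fderiv_fst (hg.of_le hle) g1]
    simp only [norm_mul, Complex.norm_I, Complex.norm_real, Complex.norm_intCast, mul_one,
      Complex.norm_ofNat, Real.norm_eq_abs, abs_of_pos Real.pi_pos]
    have hpi := Real.pi_gt_three
    calc (k : ℝ) ^ 2 * ‖planarCoeff g k l‖ = 1 * (|(k : ℝ)| ^ 2 * ‖planarCoeff g k l‖) := by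
          rw [one_mul, sq_abs]
      _ ≤ (2 * Real.pi) ^ 2 * (|(k : ℝ)| ^ 2 * ‖planarCoeff g k l‖) :=
          mul_le_mul_of_nonneg_right (by nlinarith) (by positivity)
      _ = _ := by ring
  have two : ∀ {g : ℝ × ℝ → ℂ}, ContDiff ℝ (⊤ : ℕ∞) g → (∀ p, g (p + (1, 0)) = g p) →
      (∀ p, g (p + (0, 1)) = g p) → ∃ g', ContDiff ℝ (⊤ : ℕ∞) g' ∧
      ∀ k l : ℤ, (l : ℝ) ^ 2 * ‖planarCoeff g k l‖ ≤ ‖planarCoeff g' k l‖ := by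
    intro g hg g1 g2
    have hs : ContDiff ℝ (⊤ : ℕ∞) fun p : ℝ × ℝ => p.swap := contDiff_snd.prodMk contDiff_fst
    obtain ⟨g', c0, -, -, c3⟩ := one (hg.comp hs) (fun p => by simpa using g2 p.swap)
      (fun p => by simpa using g1 p.swap)
    refine ⟨fun p => g' p.swap, c0.comp hs, fun k l => ?_⟩
    have := c3 l k
    rw [← planarCoeff_swap hg.continuous, planarCoeff_swap c0.continuous]
    exact this
  -- Coefficients of `g`, `u`, `w` dominate those of `f` times `k²`, `l²`, `k²l²`; adding the four
  -- bounds controls `(1 + k²)(1 + l²)` times the coefficient.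
  obtain ⟨g, g0, g1, g2, g3⟩ := one hf h1 h2
  obtain ⟨u, u0, u3⟩ := two hf h1 h2
  obtain ⟨w, w0, w3⟩ := two g0 g1 g2
  obtain ⟨A, hA⟩ := exists_norm_planarCoeff_le hf.continuous
  obtain ⟨B, hB⟩ := exists_norm_planarCoeff_le g0.continuous
  obtain ⟨C, hC⟩ := exists_norm_planarCoeff_le u0.continuous
  obtain ⟨D, hD⟩ := exists_norm_planarCoeff_le w0.continuous
  have hsum := (summable_inv_one_add_sq.mul_of_nonneg summable_inv_one_add_sq
    (fun _ => by positivity) (fun _ => by positivity)).mul_left (A + B + C + D)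
  refine hsum.of_nonneg_of_le (fun _ => norm_nonneg _) fun ⟨k, l⟩ => ?_
  rw [← mul_inv, ← div_eq_mul_inv, le_div_iff₀ (by positivity)]
  have k1 := (g3 k l).trans (hB k l)
  have k2 := (u3 k l).trans (hC k l)
  have k3 := (mul_le_mul_of_nonneg_left (g3 k l) (sq_nonneg (l : ℝ))).trans
    ((w3 k l).trans (hD k l))
  have k0 := hA k l
  simp only
  linarith

end PlanarAR

/-! ### The coefficients `ψ` -/

namespace PlanarAR

theorem symbol_eq_character (a b c : ℝ) (p : ℝ × ℝ) :
    symbol a b c p.1 p.2 = 1 - a * character (-1) 0 p - b * character 0 (-1) p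
      - c * character (-1) (-1) p := by
  have h1 : (2 * Real.pi * Complex.I * p.1 : ℂ)
      = -(2 * Real.pi * Complex.I * (((-1 : ℤ) : ℂ) * p.1 + ((0 : ℤ) : ℂ) * p.2)) := by
    push_cast; ring
  have h2 : (2 * Real.pi * Complex.I * p.2 : ℂ)
      = -(2 * Real.pi * Complex.I * (((0 : ℤ) : ℂ) * p.1 + ((-1 : ℤ) : ℂ) * p.2)) := by
    push_cast; ring
  have h3 : (2 * Real.pi * Complex.I * (p.1 + p.2) : ℂ)
      = -(2 * Real.pi * Complex.I * (((-1 : ℤ) : ℂ) * p.1 + ((-1 : ℤ) : ℂ) * p.2)) := by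
    push_cast; ring
  rw [symbol, h1, h2, h3]
  rfl

theorem contDiff_character (k l : ℤ) : ContDiff ℝ (⊤ : ℕ∞) (character k l) := by
  have h1 : ContDiff ℝ (⊤ : ℕ∞) fun p : ℝ × ℝ => (p.1 : ℂ) :=
    Complex.ofRealCLM.contDiff.comp contDiff_fst
  have h2 : ContDiff ℝ (⊤ : ℕ∞) fun p : ℝ × ℝ => (p.2 : ℂ) :=
    Complex.ofRealCLM.contDiff.comp contDiff_snd
  exact (contDiff_const.mul ((contDiff_const.mul h1).add (contDiff_const.mul h2))).neg.cexp

theorem character_swap (k l : ℤ) (p : ℝ × ℝ) : character k l p.swap = character l k p := by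
  simp only [character, Prod.fst_swap, Prod.snd_swap, add_comm]

theorem character_add_snd (k l : ℤ) (x y : ℝ) :
    character k l (x, y + 1) = character k l (x, y) := by
  rw [← character_swap l k (x, y + 1), ← character_swap l k (x, y)]
  exact character_add_fst l k y x

theorem symbol_add_fst (a b c x y : ℝ) : symbol a b c (x + 1) y = symbol a b c x y := by
  rw [symbol_eq_character a b c (x + 1, y), symbol_eq_character a b c (x, y)]
  simp only [character_add_fst]

theorem symbol_add_snd (a b c x y : ℝ) : symbol a b c x (y + 1) = symbol a b c x y := by
  rw [symbol_eq_character a b c (x, y + 1), symbol_eq_character a b c (x, y)]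
  simp only [character_add_snd]

theorem contDiff_symbol (a b c : ℝ) :
    ContDiff ℝ (⊤ : ℕ∞) fun p : ℝ × ℝ => symbol a b c p.1 p.2 := by
  simp only [symbol_eq_character]
  exact ((contDiff_const.sub (contDiff_const.mul (contDiff_character _ _))).sub
    (contDiff_const.mul (contDiff_character _ _))).sub
    (contDiff_const.mul (contDiff_character _ _))

theorem psi_eq_planarCoeff (a b c : ℝ) (k l : ℤ) :
    psi a b c k l = planarCoeff (fun p => (symbol a b c p.1 p.2)⁻¹) k l := rfl

theorem contDiff_inv_symbol {a b c : ℝ} (h : 0 < discr a b c) :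
    ContDiff ℝ (⊤ : ℕ∞) fun p : ℝ × ℝ => (symbol a b c p.1 p.2)⁻¹ :=
  (contDiff_symbol a b c).inv fun p => symbol_ne_zero h p.1 p.2

theorem summable_norm_psi {a b c : ℝ} (h : 0 < discr a b c) :
    Summable fun p : ℤ × ℤ => ‖psi a b c p.1 p.2‖ := by
  simp only [psi_eq_planarCoeff]
  refine summable_norm_planarCoeff (contDiff_inv_symbol h) (fun p => ?_) (fun p => ?_)
  · simp only [Prod.fst_add, Prod.snd_add, add_zero, symbol_add_fst]
  · simp only [Prod.fst_add, Prod.snd_add, add_zero, symbol_add_snd]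

/-- The derivatives of a constant vanish, so integration by parts kills every coefficient with `k ≠
0` or `l ≠ 0`. -/
theorem planarCoeff_one (k l : ℤ) :
    planarCoeff (fun _ => 1) k l = if (k, l) = (0 : ℤ × ℤ) then 1 else 0 := by
  have hpi : (2 * Real.pi * Complex.I : ℂ) ≠ 0 := Complex.two_pi_I_ne_zero
  have h1 := planarCoeff_fderiv_fst (f := fun _ => 1) contDiff_const (fun _ => rfl) k l
  have h2 := planarCoeff_fderiv_snd (f := fun _ => 1) contDiff_const (fun _ => rfl) k l
  have h0 : planarCoeff (fun _ => (0 : ℂ)) k l = 0 := by simp [planarCoeff]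
  simp only [fderiv_fun_const, Pi.zero_apply, _root_.zero_apply, h0] at h1 h2
  split_ifs with h
  · obtain ⟨rfl, rfl⟩ := Prod.mk.inj h
    simp only [planarCoeff, character]
    norm_num
  · rcases mul_eq_zero.1 h1.symm with h1 | h1
    · rcases mul_eq_zero.1 h2.symm with h2 | h2
      · refine absurd (Prod.ext ?_ ?_) h
        · exact_mod_cast (mul_eq_zero.1 h1).resolve_left hpi
        · exact_mod_cast (mul_eq_zero.1 h2).resolve_left hpi
      · exact h2
    · exact h1

/-- The coefficients `ψ` invert the autoregressive polynomial. -/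
theorem psi_recursion {a b c : ℝ} (h : 0 < discr a b c) (k l : ℤ) :
    psi a b c k l = a * psi a b c (k - 1) l + b * psi a b c k (l - 1)
      + c * psi a b c (k - 1) (l - 1) + if (k, l) = (0 : ℤ × ℤ) then 1 else 0 := by
  have hc := continuous_character
  set f : ℝ × ℝ → ℂ := fun p => (symbol a b c p.1 p.2)⁻¹ with hf
  have hcont : Continuous f := (contDiff_inv_symbol h).continuous
  -- In the product of the symbol with its reciprocal, each character factor shifts the coefficient
  -- index.
  have h1 : ∀ p, (1 : ℂ) = f p - a * (character (-1) 0 p * f p) - b * (character 0 (-1) p * f p)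
      - c * (character (-1) (-1) p * f p) := by
    intro p
    have hs := mul_inv_cancel₀ (symbol_ne_zero h p.1 p.2)
    nth_rw 1 [symbol_eq_character] at hs
    simp only [hf]
    linear_combination -hs
  rw [← planarCoeff_one, funext h1, planarCoeff_sub (by fun_prop) (by fun_prop),
    planarCoeff_sub (by fun_prop) (by fun_prop), planarCoeff_sub (by fun_prop) (by fun_prop),
    planarCoeff_const_mul, planarCoeff_const_mul, planarCoeff_const_mul,
    planarCoeff_character_mul, planarCoeff_character_mul, planarCoeff_character_mul]
  simp only [psi_eq_planarCoeff, ← sub_eq_add_neg, add_zero, ← hf]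
  ring

theorem conj_character (k l : ℤ) (p : ℝ × ℝ) :
    (starRingEnd ℂ) (character k l p) = character k l (-p) := by
  rw [character, ← Complex.exp_conj, character]
  simp only [map_neg, map_mul, map_add, Complex.conj_ofReal, Complex.conj_I, map_intCast,
    map_ofNat, Prod.fst_neg, Prod.snd_neg, Complex.ofReal_neg]
  congr 1
  ring

/-- Conjugating the integrand amounts to `(x, y) ↦ (-x, -y)`, which preserves the square. -/
theorem psi_im (a b c : ℝ) (k l : ℤ) : (psi a b c k l).im = 0 := by
  rw [← Complex.conj_eq_iff_im, psi_eq_planarCoeff, planarCoeff]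
  have hs : ∀ x y : ℝ, (starRingEnd ℂ) (symbol a b c x y) = symbol a b c (-x) (-y) := by
    intro x y
    rw [symbol_eq_character a b c (x, y), symbol_eq_character a b c (-x, -y)]
    simp [conj_character]
  simp only [← intervalIntegral.intervalIntegral_conj, map_mul, conj_character, map_inv₀, hs,
    Prod.neg_mk]
  rw [intervalIntegral.integral_comp_neg fun y => ∫ x in (-(1 / 2) : ℝ)..(1 / 2),
    character k l (-x, y) * (symbol a b c (-x) y)⁻¹, neg_neg]
  congr 1 with y
  rw [intervalIntegral.integral_comp_neg fun x => character k l (x, y) * (symbol a b c x y)⁻¹,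
    neg_neg]

end PlanarAR

/-! ### Normally convergent series in `L²` and the moving average -/

namespace PlanarAR

variable {Ω : Type*} [MeasurableSpace Ω] {μ : Measure Ω}

section SquareIntegrableSeries

theorem inner_toLp {X Y : Ω → ℝ} (hX : MemLp X 2 μ) (hY : MemLp Y 2 μ) :
    inner ℝ (hX.toLp X) (hY.toLp Y) = ∫ ω, X ω * Y ω ∂μ := by
  rw [L2.inner_def]
  refine integral_congr_ae ?_
  filter_upwards [hX.coeFn_toLp, hY.coeFn_toLp] with ω h1 h2
  rw [h1, h2]
  exact mul_comm _ _

theorem covariance_eq_inner [IsProbabilityMeasure μ] {X Y : Ω → ℝ} (hX : MemLp X 2 μ)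
    (hY : MemLp Y 2 μ) (h0 : ∫ ω, X ω ∂μ = 0) :
    covariance X Y μ = inner ℝ (hX.toLp X) (hY.toLp Y) := by
  rw [covariance_eq_sub hX hY, h0, zero_mul, sub_zero, inner_toLp]
  rfl

variable {ι : Type*} [Countable ι] {f g : ι → Ω → ℝ} (hf : ∀ i, MemLp (f i) 2 μ)
  (hg : ∀ i, MemLp (g i) 2 μ)

/-- Links the pointwise sum to the `L²` sum, so that facts about either pass to the other. -/
theorem ae_hasSum_of_summable_norm (hs : Summable fun i => ‖(hf i).toLp (f i)‖) :
    ∀ᵐ ω ∂μ, HasSum (fun i => f i ω) ((∑' i, (hf i).toLp (f i) : Lp ℝ 2 μ) ω) := by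
  filter_upwards [Lp.hasSum_coeFn_tsum (tsum_enorm_ne_top_iff_summable_norm.2 hs),
    ae_all_iff.2 fun i => (hf i).coeFn_toLp] with ω h1 h2
  simpa only [h2] using h1

theorem memLp_tsum (hs : Summable fun i => ‖(hf i).toLp (f i)‖) :
    MemLp (fun ω => ∑' i, f i ω) 2 μ :=
  (Lp.memLp (∑' i, (hf i).toLp (f i))).ae_eq
    ((ae_hasSum_of_summable_norm hf hs).mono fun _ h => h.tsum_eq.symm)

theorem hasSum_toLp (hs : Summable fun i => ‖(hf i).toLp (f i)‖) :
    HasSum (fun i => (hf i).toLp (f i)) ((memLp_tsum hf hs).toLp _) := by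
  convert hs.of_norm.hasSum
  refine Lp.ext ?_
  filter_upwards [(memLp_tsum hf hs).coeFn_toLp, ae_hasSum_of_summable_norm hf hs] with ω h1 h2
  rw [h1, h2.tsum_eq]

theorem tendsto_eLpNorm_tsum_sub_sum (hs : Summable fun i => ‖(hf i).toLp (f i)‖) :
    Tendsto (fun s : Finset ι => eLpNorm (fun ω => ∑' i, f i ω - ∑ i ∈ s, f i ω) 2 μ)
      atTop (𝓝 0) := by
  have h1 := tendsto_const_nhds (x := (memLp_tsum hf hs).toLp _) |>.sub (hasSum_toLp hf hs)
  rw [sub_self] at h1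
  have h2 := h1.enorm
  rw [enorm_zero] at h2
  refine h2.congr fun s => ?_
  rw [Lp.enorm_def]
  refine eLpNorm_congr_ae ?_
  filter_upwards [Lp.coeFn_sub ((memLp_tsum hf hs).toLp _) (∑ i ∈ s, (hf i).toLp (f i)),
    (memLp_tsum hf hs).coeFn_toLp, Lp.coeFn_fun_finsetSum s fun i => (hf i).toLp (f i),
    ae_all_iff.2 fun i => (hf i).coeFn_toLp] with ω h1 h2 h3 h4
  rw [h1, Pi.sub_apply, h2, h3]
  simp only [h4]

theorem integral_tsum_eq_zero [IsProbabilityMeasure μ]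
    (hs : Summable fun i => ‖(hf i).toLp (f i)‖) (h0 : ∀ i, ∫ ω, f i ω ∂μ = 0) :
    ∫ ω, ∑' i, f i ω ∂μ = 0 := by
  have hone : MemLp (fun _ : Ω => (1 : ℝ)) 2 μ := memLp_const 1
  have h1 := (innerSL ℝ (hone.toLp _)).hasSum (hasSum_toLp hf hs)
  simp only [innerSL_apply_apply, inner_toLp, one_mul, h0] at h1
  exact h1.unique hasSum_zero

/-- For centred variables covariance is the `L²` inner product, which is continuous in each
argument. -/
theorem covariance_tsum_tsum [IsProbabilityMeasure μ]
    (hfs : Summable fun i => ‖(hf i).toLp (f i)‖) (hgs : Summable fun i => ‖(hg i).toLp (g i)‖)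
    (hf0 : ∀ i, ∫ ω, f i ω ∂μ = 0) :
    covariance (fun ω => ∑' i, f i ω) (fun ω => ∑' i, g i ω) μ
      = ∑' i, ∑' j, covariance (f i) (g j) μ := by
  rw [covariance_eq_inner (memLp_tsum hf hfs) (memLp_tsum hg hgs)
    (integral_tsum_eq_zero hf hfs hf0), real_inner_comm]
  have h1 := (innerSL ℝ ((memLp_tsum hg hgs).toLp _)).hasSum (hasSum_toLp hf hfs)
  simp only [innerSL_apply_apply] at h1
  rw [← h1.tsum_eq]
  refine tsum_congr fun i => ?_
  have h2 := (innerSL ℝ ((hf i).toLp _)).hasSum (hasSum_toLp hg hgs)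
  simp only [innerSL_apply_apply] at h2
  rw [real_inner_comm, ← h2.tsum_eq]
  exact tsum_congr fun j => (covariance_eq_inner (hf i) (hg j) (hf0 i)).symm

end SquareIntegrableSeries

section MovingAverage

variable {a b c v : ℝ} {ε : ℤ → ℤ → Ω → ℝ}

theorem IsWhiteNoise.memLp_maTerm (hε : IsWhiteNoise μ v ε) (i j : ℤ) (p : ℤ × ℤ) :
    MemLp (maTerm a b c ε i j p) 2 μ :=
  (hε.memLp _ _).const_mul _

theorem IsWhiteNoise.integral_maTerm (hε : IsWhiteNoise μ v ε) (i j : ℤ) (p : ℤ × ℤ) :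
    ∫ ω, maTerm a b c ε i j p ω ∂μ = 0 := by
  simp only [maTerm, integral_const_mul, hε.mean_zero, mul_zero]

theorem IsWhiteNoise.covariance_maTerm (hε : IsWhiteNoise μ v ε) (i j k l : ℤ) (p q : ℤ × ℤ) :
    covariance (maTerm a b c ε i j p) (maTerm a b c ε k l q) μ
      = (psi a b c p.1 p.2).re * ((psi a b c q.1 q.2).re
        * if (i - k, j - l) = p - q then v else 0) := by
  unfold maTerm
  rw [covariance_const_mul_left, covariance_const_mul_right]
  congr 2
  split_ifs with h
  · have h1 : i - p.1 = k - q.1 := by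
      have := congrArg Prod.fst h
      simp only [Prod.fst_sub] at this
      omega
    have h2 : j - p.2 = l - q.2 := by
      have := congrArg Prod.snd h
      simp only [Prod.snd_sub] at this
      omega
    rw [h1, h2, covariance_self (hε.memLp _ _).aemeasurable, hε.variance_eq]
  · refine hε.uncorrelated _ _ _ _ fun h' => h ?_
    obtain ⟨h1, h2⟩ := Prod.mk.inj h'
    ext
    · simp only [Prod.fst_sub]; omega
    · simp only [Prod.snd_sub]; omega

/-- Each term has norm at most `|ψ|√v`, so absolute summability of `ψ` suffices. -/
theorem IsWhiteNoise.summable_norm_maTerm [IsProbabilityMeasure μ] (hε : IsWhiteNoise μ v ε)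
    (hD : 0 < discr a b c) (i j : ℤ) :
    Summable fun p => ‖(hε.memLp_maTerm (a := a) (b := b) (c := c) i j p).toLp _‖ := by
  refine ((summable_norm_psi hD).mul_right √v).of_nonneg_of_le (fun _ => norm_nonneg _) fun p => ?_
  have h1 := hε.covariance_maTerm (a := a) (b := b) (c := c) i j i j p p
  rw [covariance_eq_inner (hε.memLp_maTerm i j p) (hε.memLp_maTerm i j p)
    (hε.integral_maTerm i j p), real_inner_self_eq_norm_sq] at h1
  simp only [sub_self, Prod.mk_zero_zero, if_true] at h1
  have hv : 0 ≤ v := by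
    rw [← hε.variance_eq 0 0]; exact variance_nonneg _ _
  refine (sq_le_sq₀ (norm_nonneg _) (by positivity)).1 ?_
  rw [h1, mul_pow, Real.sq_sqrt hv, ← mul_assoc, ← pow_two]
  refine mul_le_mul_of_nonneg_right ?_ hv
  rw [sq_le_sq, abs_norm]
  exact Complex.abs_re_le_norm _

theorem IsWhiteNoise.ae_summable_abs_maTerm [IsProbabilityMeasure μ] (hε : IsWhiteNoise μ v ε)
    (hD : 0 < discr a b c) (i j : ℤ) :
    ∀ᵐ ω ∂μ, Summable fun p => |maTerm a b c ε i j p ω| :=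
  (ae_hasSum_of_summable_norm _ (hε.summable_norm_maTerm hD i j)).mono fun _ h => h.summable.abs

theorem IsWhiteNoise.isWideSenseStationary_movingAverage [IsProbabilityMeasure μ]
    (hε : IsWhiteNoise μ v ε) (hD : 0 < discr a b c) :
    IsWideSenseStationary μ (movingAverage a b c ε) where
  memLp i j := memLp_tsum _ (hε.summable_norm_maTerm hD i j)
  mean_const := ⟨0, fun i j =>
    integral_tsum_eq_zero _ (hε.summable_norm_maTerm hD i j) (hε.integral_maTerm i j)⟩
  cov_shift := by
    refine ⟨fun h₁ h₂ => ∑' p : ℤ × ℤ, ∑' q : ℤ × ℤ, (psi a b c p.1 p.2).re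
      * ((psi a b c q.1 q.2).re * if (h₁, h₂) = p - q then v else 0), fun i j h₁ h₂ => ?_⟩
    refine (covariance_tsum_tsum _ _ (hε.summable_norm_maTerm hD i j)
      (hε.summable_norm_maTerm hD (i - h₁) (j - h₂)) (hε.integral_maTerm i j)).trans ?_
    simp only [hε.covariance_maTerm, sub_sub_cancel]

theorem IsWhiteNoise.solvesAR_movingAverage [IsProbabilityMeasure μ]
    (hε : IsWhiteNoise μ v ε) (hD : 0 < discr a b c) :
    SolvesAR μ a b c ε (movingAverage a b c ε) := by
  intro i j
  filter_upwards [hε.ae_summable_abs_maTerm hD i j, hε.ae_summable_abs_maTerm hD (i - 1) j,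
    hε.ae_summable_abs_maTerm hD i (j - 1), hε.ae_summable_abs_maTerm hD (i - 1) (j - 1)]
    with ω s₀ s₁ s₂ s₃
  set r : ℤ × ℤ → ℝ := fun p => (psi a b c p.1 p.2).re with hr
  set E : ℤ × ℤ → ℝ := fun p => ε (i - p.1) (j - p.2) ω with hE
  -- Reindexing expresses all four series through the same noise values `E`, so that only
  -- coefficients need comparing.
  have hshift : ∀ m n : ℤ, (Summable fun p => |maTerm a b c ε (i - m) (j - n) p ω|) →
      HasSum (fun p => r (p - (m, n)) * E p) (movingAverage a b c ε (i - m) (j - n) ω) := by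
    intro m n hs
    rw [← (Equiv.addRight ((m, n) : ℤ × ℤ)).hasSum_iff]
    refine hs.of_abs.hasSum.congr_fun fun p => ?_
    simp [maTerm, hr, hE, sub_sub, add_comm]
  have h0 := hshift 0 0 (by simpa using s₀)
  have h1 := hshift 1 0 (by simpa using s₁)
  have h2 := hshift 0 1 (by simpa using s₂)
  have h3 := hshift 1 1 s₃
  have hδ : HasSum (fun p => (if p = 0 then 1 else 0) * E p) (ε i j ω) := by
    convert hasSum_ite_eq (0 : ℤ × ℤ) (ε i j ω) using 2 with p
    split_ifs with h
    · simp [h, hE]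
    · rw [zero_mul]
  simp only [sub_zero, Prod.mk_zero_zero] at h0 h1 h2
  refine h0.unique (((((h1.mul_left a).add (h2.mul_left b)).add (h3.mul_left c)).add hδ).congr_fun
    fun p => ?_)
  -- Since `a`, `b`, `c` are real, the real parts obey the same recursion.
  have hp := congrArg Complex.re (psi_recursion hD p.1 p.2)
  simp only [Complex.add_re, Complex.re_ofReal_mul, apply_ite Complex.re, Complex.one_re,
    Complex.zero_re] at hp
  change r p = a * r (p.1 - 1, p.2) + b * r (p.1, p.2 - 1) + c * r (p.1 - 1, p.2 - 1)
    + (if p = 0 then 1 else 0) at hp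
  have e1 : p - (1, 0) = (p.1 - 1, p.2) := by ext <;> simp
  have e2 : p - (0, 1) = (p.1, p.2 - 1) := by ext <;> simp
  have e3 : p - (1, 1) = (p.1 - 1, p.2 - 1) := rfl
  rw [e1, e2, e3, hp]
  ring

end MovingAverage

end PlanarAR

theorem mainTheorem2 {Ω : Type*} [MeasurableSpace Ω] (μ : Measure Ω) [IsProbabilityMeasure μ]
    (a b c v : ℝ) (hv : 0 < v) (ε : ℤ → ℤ → Ω → ℝ) (hε : PlanarAR.IsWhiteNoise μ v ε) :
    ((∃ X : ℤ → ℤ → Ω → ℝ,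
        PlanarAR.IsWideSenseStationary μ X ∧ PlanarAR.SolvesAR μ a b c ε X) ↔
      0 < PlanarAR.discr a b c) ∧
    (0 < PlanarAR.discr a b c →
      (∀ ν₁ ν₂ : ℝ, PlanarAR.symbol a b c ν₁ ν₂ ≠ 0) ∧
      (∀ k l : ℤ, (PlanarAR.psi a b c k l).im = 0) ∧
      Summable (fun p : ℤ × ℤ => ‖PlanarAR.psi a b c p.1 p.2‖) ∧
      (∀ i j : ℤ, ∀ᵐ ω ∂μ,
        Summable (fun p : ℤ × ℤ => |PlanarAR.maTerm a b c ε i j p ω|)) ∧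
      (∀ i j : ℤ, Tendsto
        (fun s : Finset (ℤ × ℤ) =>
          eLpNorm (fun ω => PlanarAR.movingAverage a b c ε i j ω
            - ∑ p ∈ s, PlanarAR.maTerm a b c ε i j p ω) 2 μ)
        atTop (𝓝 0)) ∧
      PlanarAR.IsWideSenseStationary μ (PlanarAR.movingAverage a b c ε) ∧
      PlanarAR.SolvesAR μ a b c ε (PlanarAR.movingAverage a b c ε)) := by
  refine ⟨⟨fun ⟨X, hX, hAR⟩ => PlanarAR.discr_pos_of_exists hv hε hX hAR, fun hD =>
    ⟨_, hε.isWideSenseStationary_movingAverage hD, hε.solvesAR_movingAverage hD⟩⟩, fun hD => ?_⟩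
  exact ⟨PlanarAR.symbol_ne_zero hD, PlanarAR.psi_im a b c, PlanarAR.summable_norm_psi hD,
    hε.ae_summable_abs_maTerm hD,
    fun i j => PlanarAR.tendsto_eLpNorm_tsum_sub_sum _ (hε.summable_norm_maTerm hD i j),
    hε.isWideSenseStationary_movingAverage hD, hε.solvesAR_movingAverage hD⟩
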